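/- Let $(x_k)_{k\ge 1}$ and $(y_k)_{k\ge 1}$ be real random variables on a probability space $(\Omega,\mathcal F,\mathbb P)$, all mutually independent and with the same law $\nu$. Assume that $\mathbb E[x_1]=0$, $\mathbb E[x_1^2]=1$ and $\mathbb E[|x_1|^q]<\infty$ for some integer $q>2$. Let $b\ge 0$ and assume that $\nu$ belongs to the class $\mathcal C(1,b)$ (weak Cramer condition), i.e. there are constants $C>0$ and $R>0$ such that $$\Big|\int_{\mathbb R} e^{itu}\,\nu(du)\Big|\le 1-\frac{C}{|t|^{b}}\qquad\text{for all real } t \text{ with } |t|>R .$$ Let $(\varphi_k)_{k\ge 1}$ be any sequence of real numbers, let $\alpha\le\beta$ be real numbers and, for $n\ge 1$, $t\in\mathbb R$, put $$U_n(t)=\frac1{\sqrt n}\sum_{k=1}^n\Big(x_k\cos\big(\tfrac{kt}{n}+\varphi_k\big)+y_k\sin\big(\tfrac{kt}{n}+\varphi_k\big)\Big),\qquad \omega_n(U)=\inf_{t\in[\alpha n,\beta n]}\big(|U_n(t)|+|U_n'(t)|\big).$$ If $\frac1q<\frac1b-\frac12$ (with $\frac1b=+\infty$ when $b=0$), then for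 every real $\theta<-1-\frac1q$, $$\lim_{n\to+\infty}\mathbb P\big(\omega_n(U)<n^{\theta}\big)=0 .$$ -/

import Mathlib

open MeasureTheory

/-- The weak Cramer condition with exponent `b` for a measure `ν` on a Euclidean space `E`:
`ν` is a probability measure and there are `C, R > 0` such that
`|φ_ν(t)| ≤ 1 - C / ‖t‖ ^ b` whenever `‖t‖ > R`, where `φ_ν(t) = ∫ exp(i ⟨x, t⟩) dν(x)`.
For `E = ℝ` this is membership in the class `C(1, b)`.  For `b = 0` it is the classical
Cramer condition `limsup |φ_ν(t)| < 1`. -/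
def WeakCramer {E : Type*} [NormedAddCommGroup E] [InnerProductSpace ℝ E] [MeasurableSpace E]
    (ν : Measure E) (b : ℝ) : Prop :=
  IsProbabilityMeasure ν ∧
    ∃ C : ℝ, 0 < C ∧ ∃ R : ℝ, 0 < R ∧ ∀ t : E, R < ‖t‖ → ‖charFun ν t‖ ≤ 1 - C / ‖t‖ ^ b

/-- The normalized trigonometric polynomial with coefficient sequences `x`, `y` and phases `φ`,
`t ↦ n ^ (-1/2) ∑_{k=1}^n (x_k cos (k t / n + φ_k) + y_k sin (k t / n + φ_k))`.
The entries of index `0` are never used. -/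
noncomputable def trigPoly (x y φ : ℕ → ℝ) (n : ℕ) (t : ℝ) : ℝ :=
  1 / √(n : ℝ) * ∑ k ∈ Finset.Icc 1 n,
    (x k * Real.cos (k * t / n + φ k) + y k * Real.sin (k * t / n + φ k))

/-- `inf_{t ∈ [c, d]} (|f t| + |f' t|)`, used for `c ≤ d` and differentiable `f`. -/
noncomputable def infAbsAddAbsDeriv (f : ℝ → ℝ) (c d : ℝ) : ℝ :=
  ⨅ t : Set.Icc c d, (|f t| + |deriv f t|)

/-! Put p = 1/q. If |U| + |U'| is tiny at some t, then U and U' are both small at a nearby point of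
a grid of mesh δ = n^(-1-p), so a union bound over about n^(2+p) grid points suffices, provided two
things hold.

Transfer to the grid. Markov's inequality at order q shows that all coefficients are at most √n
outside an event of probability O(n^(1-q/2)), which vanishes as q > 2. On the good event |U'''| ≤
2n, and nδ ≤ 1. Hence at a neighbouring grid point either |U''| ≥ l = n^(p/8), which a Chernoff
bound makes exponentially unlikely, or |U| and |U'| are both at most η = δ(l+4)
(`exists_grid_point_of_infAbsAddAbsDeriv_lt`).

Small balls. At a fixed point, P(|U| ≤ η, |U'| ≤ η) is O(η²) up to negligible errors
(`measureReal_abs_trigPoly_le`). Summed over the grid this is O(n^(2+p) η²) = O(n^(-3p/4)). The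
estimate is Fourier analytic and needs no normal approximation: Gaussian smoothing reduces it to the
characteristic function of (U, U')/η. At low frequencies that function has Gaussian decay, because
weak Cramer at infinity forces quadratic decay near 0 (`WeakCramer.exists_decay`). At high
frequencies each coefficient sees arguments of size at most about n^(1/2+p), so the product over n
indices is at most exp(-c n^(1-b(1/2+p))). The exponent is positive exactly when 1/q < 1/b - 1/2, or
when b = 0. -/

/-! ### Characteristic functions under the weak Cramer condition -/

section CharFunDecay

open Complex in
lemma re_exp_mul_charFun (ν : Measure ℝ) [IsProbabilityMeasure ν] (t θ : ℝ) :
    (exp (-(θ * I)) * charFun ν t).re = ∫ x, Real.cos (t * x - θ) ∂ν := by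
  have hint : Integrable (fun x : ℝ => exp (-(θ * I)) * exp (t * x * I)) ν := by
    refine Integrable.const_mul ?_ _
    refine Integrable.of_bound (C := 1) (by fun_prop) (Filter.Eventually.of_forall fun x => ?_)
    rw [← ofReal_mul, norm_exp_ofReal_mul_I]
  rw [charFun_apply_real, ← integral_const_mul]
  have := integral_re hint
  simp only [RCLike.re_to_complex] at this
  rw [← this]
  refine integral_congr_ae (Filter.Eventually.of_forall fun x => ?_)
  simp only
  rw [← exp_add, ← exp_ofReal_mul_I_re]
  congr 2
  push_cast
  ring

/-- Rotating by the argument θ of the value at t turns its modulus into the mean of cos(tx - θ).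
Then cos 2a ≥ 4 cos a - 3, which is 2(1 - cos a)² ≥ 0, is integrated with a = tx - θ. -/
lemma one_sub_norm_charFun_two_mul_le (ν : Measure ℝ) [IsProbabilityMeasure ν] (t : ℝ) :
    1 - ‖charFun ν (2 * t)‖ ≤ 4 * (1 - ‖charFun ν t‖) := by
  set θ := (charFun ν t).arg
  have hcos : ∀ s a : ℝ, Integrable (fun x : ℝ => Real.cos (s * x - a)) ν := fun s a =>
    Integrable.of_bound (C := 1) (by fun_prop)
      (Filter.Eventually.of_forall fun x => Real.abs_cos_le_one _)
  have h1 : ‖charFun ν t‖ = ∫ x, Real.cos (t * x - θ) ∂ν := by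
    rw [← re_exp_mul_charFun]
    conv_rhs => rw [← Complex.norm_mul_exp_arg_mul_I (charFun ν t)]
    rw [mul_left_comm, ← Complex.exp_add]
    simp [θ]
  have h2 : ∫ x, Real.cos (2 * t * x - 2 * θ) ∂ν ≤ ‖charFun ν (2 * t)‖ := by
    rw [← re_exp_mul_charFun]
    refine (Complex.re_le_norm _).trans ?_
    rw [norm_mul, Complex.norm_exp]
    simp
  have h3 : ∫ x, (4 * Real.cos (t * x - θ) - 3) ∂ν ≤ ∫ x, Real.cos (2 * t * x - 2 * θ) ∂ν := by
    refine integral_mono (((hcos _ _).const_mul _).sub (integrable_const _)) (hcos _ _) fun x => ?_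
    have : 2 * t * x - 2 * θ = 2 * (t * x - θ) := by ring
    simp only
    rw [this, Real.cos_two_mul]
    nlinarith [sq_nonneg (1 - Real.cos (t * x - θ))]
  rw [integral_sub ((hcos _ _).const_mul _) (integrable_const _), integral_const_mul, ← h1] at h3
  simp at h3
  linarith

lemma one_sub_norm_charFun_two_pow_mul_le (ν : Measure ℝ) [IsProbabilityMeasure ν] (t : ℝ)
    (m : ℕ) : 1 - ‖charFun ν (2 ^ m * t)‖ ≤ 4 ^ m * (1 - ‖charFun ν t‖) := by
  induction m with
  | zero => simp
  | succ m ih =>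
    have := one_sub_norm_charFun_two_mul_le ν (2 ^ m * t)
    rw [pow_succ', mul_assoc, pow_succ', mul_assoc]
    linarith

/-- A weak Cramer condition at infinity forces quadratic decay of the characteristic function
near zero. -/
lemma WeakCramer.exists_decay {ν : Measure ℝ} {b : ℝ} (hb : 0 ≤ b) (h : WeakCramer ν b) :
    ∃ κ > 0, ∃ R > 0, ∀ t : ℝ, (|t| ≤ R → ‖charFun ν t‖ ≤ Real.exp (-(κ * t ^ 2))) ∧
      (R < |t| → ‖charFun ν t‖ ≤ Real.exp (-(κ / |t| ^ b))) := by
  obtain ⟨hν, C, hC, R, hR, hCR⟩ := h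
  have hD : 0 < C / (4 * R ^ 2 * (2 * R) ^ b) := by positivity
  refine ⟨min C (C / (4 * R ^ 2 * (2 * R) ^ b)), lt_min hC hD, R, hR, fun t => ⟨fun ht => ?_,
    fun ht => ?_⟩⟩
  · rcases eq_or_ne t 0 with rfl | h0
    · simp
    have ht0 : 0 < |t| := abs_pos.2 h0
    -- Doubling t until it first leaves [-R, R] gives R < 2^(m+1)|t| ≤ 2R. There the gap to 1 is at
    -- least C/(2R)^b; carrying it back costs 4^(m+1) ≤ 4R²/t², hence the constant in `hD`.
    obtain ⟨m, hm1, hm2⟩ := exists_nat_pow_near ((one_le_div ht0).2 ht) (one_lt_two (α := ℝ))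
    rw [le_div_iff₀ ht0] at hm1
    rw [div_lt_iff₀ ht0] at hm2
    have hle : 2 ^ (m + 1) * |t| ≤ 2 * R := by rw [pow_succ']; linarith
    have hnorm : ‖(2 : ℝ) ^ (m + 1) * t‖ = 2 ^ (m + 1) * |t| := by
      rw [Real.norm_eq_abs, abs_mul, abs_of_pos (by positivity)]
    have h1 := hCR (2 ^ (m + 1) * t) (by rwa [hnorm])
    rw [hnorm] at h1
    have h2 := one_sub_norm_charFun_two_pow_mul_le ν t (m + 1)
    have h3 : C / (2 * R) ^ b ≤ C / (2 ^ (m + 1) * |t|) ^ b := by gcongr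
    have h4 : C / (2 * R) ^ b ≤ 4 ^ (m + 1) * (1 - ‖charFun ν t‖) := by linarith
    have h5 : (4 : ℝ) ^ (m + 1) * t ^ 2 ≤ 4 * R ^ 2 := by
      have := pow_le_pow_left₀ (by positivity) hle 2
      rw [mul_pow, mul_pow, sq_abs, ← pow_mul, mul_comm (m + 1), pow_mul] at this
      norm_num at this ⊢
      exact this
    have h6 : C / (4 * R ^ 2 * (2 * R) ^ b) * t ^ 2 ≤ 1 - ‖charFun ν t‖ := by
      rw [mul_comm (4 * R ^ 2), ← div_div, div_mul_eq_mul_div, div_le_iff₀ (by positivity)]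
      have h7 : 0 ≤ 1 - ‖charFun ν t‖ := by linarith [norm_charFun_le_one (μ := ν) t]
      nlinarith [mul_le_mul_of_nonneg_right h4 (sq_nonneg t), mul_le_mul_of_nonneg_right h5 h7]
    have h8 := Real.add_one_le_exp
      (-(min C (C / (4 * R ^ 2 * (2 * R) ^ b)) * t ^ 2))
    have h9 := mul_le_mul_of_nonneg_right (min_le_right C (C / (4 * R ^ 2 * (2 * R) ^ b)))
      (sq_nonneg t)
    linarith
  · have h1 := hCR t ht
    rw [Real.norm_eq_abs] at h1
    have h2 : min C (C / (4 * R ^ 2 * (2 * R) ^ b)) / |t| ^ b ≤ C / |t| ^ b := by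
      gcongr
      exact min_le_left _ _
    have h3 := Real.add_one_le_exp (-(min C (C / (4 * R ^ 2 * (2 * R) ^ b)) / |t| ^ b))
    linarith

/-- The argument of larger modulus carries at least half of s² + t², whence κ/2; the other factor is
bounded by 1. Only s² + t² enters, the one quantity that will not depend on the phases. -/
lemma WeakCramer.exists_norm_charFun_mul_le {ν : Measure ℝ} {b : ℝ} (hb : 0 ≤ b)
    (h : WeakCramer ν b) :
    ∃ κ > 0, ∀ s t r₁ r₂ : ℝ, r₁ ≤ s ^ 2 + t ^ 2 → s ^ 2 + t ^ 2 ≤ r₂ →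
      ‖charFun ν s * charFun ν t‖ ≤ Real.exp (-(κ * min r₁ (r₂ ^ (-(b / 2))))) := by
  obtain ⟨κ, hκ, R, hR, hdec⟩ := h.exists_decay hb
  have := h.1
  have key : ∀ s t r₁ r₂ : ℝ, |t| ≤ |s| → r₁ ≤ s ^ 2 + t ^ 2 → s ^ 2 + t ^ 2 ≤ r₂ →
      ‖charFun ν s‖ ≤ Real.exp (-(κ / 2 * min r₁ (r₂ ^ (-(b / 2))))) := by
    intro s t r₁ r₂ hts h1 h2
    have hsq : t ^ 2 ≤ s ^ 2 := sq_le_sq.2 hts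
    rcases le_or_gt |s| R with hs | hs
    · refine ((hdec s).1 hs).trans (Real.exp_le_exp.2 (neg_le_neg ?_))
      have : min r₁ (r₂ ^ (-(b / 2))) ≤ 2 * s ^ 2 := (min_le_left _ _).trans (by linarith)
      nlinarith
    · refine ((hdec s).2 hs).trans (Real.exp_le_exp.2 (neg_le_neg ?_))
      have hs0 : 0 < |s| := hR.trans hs
      have hr : |s| ^ 2 ≤ r₂ := by rw [sq_abs]; nlinarith [sq_nonneg t]
      have h3 : r₂ ^ (-(b / 2)) ≤ (|s| ^ 2) ^ (-(b / 2)) :=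
        Real.rpow_le_rpow_of_nonpos (by positivity) hr (by linarith)
      have h4 : (|s| ^ 2) ^ (-(b / 2)) = (|s| ^ b)⁻¹ := by
        rw [← Real.rpow_natCast, ← Real.rpow_mul hs0.le, ← Real.rpow_neg hs0.le]
        congr 1
        push_cast
        ring
      have h5 : 0 < (|s| ^ b)⁻¹ := by positivity
      have h6 : min r₁ (r₂ ^ (-(b / 2))) ≤ (|s| ^ b)⁻¹ :=
        (min_le_right _ _).trans (h3.trans_eq h4)
      rw [div_eq_mul_inv κ (|s| ^ b)]
      nlinarith
  refine ⟨κ / 2, by positivity, fun s t r₁ r₂ h1 h2 => ?_⟩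
  rw [norm_mul]
  rcases le_total |t| |s| with hts | hts
  · exact (mul_le_of_le_one_right (norm_nonneg _) (norm_charFun_le_one t)).trans
      (key s t r₁ r₂ hts h1 h2)
  · exact (mul_le_of_le_one_left (norm_nonneg _) (norm_charFun_le_one s)).trans
      (key t s r₁ r₂ hts (by linarith) (by linarith))

end CharFunDecay

/-! ### Small ball estimates by Gaussian smoothing -/

section SmallBall

open ProbabilityTheory

lemma integral_exp_neg_mul_sq_gaussianReal (κ : ℝ) :
    ∫ x, Real.exp (-(κ * x ^ 2)) ∂(gaussianReal 0 1) =
      (√(2 * Real.pi))⁻¹ * √(Real.pi / (κ + 1 / 2)) := by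
  rw [integral_gaussianReal_eq_integral_smul one_ne_zero, ← integral_gaussian,
    ← integral_const_mul]
  refine integral_congr_ae (Filter.Eventually.of_forall fun x => ?_)
  simp only [gaussianPDFReal, smul_eq_mul, NNReal.coe_one, mul_one]
  rw [mul_assoc, ← Real.exp_add]
  congr 2
  ring

lemma integral_exp_neg_mul_sq_prod_gaussianReal_le {κ : ℝ} (hκ : 0 < κ) :
    ∫ g, Real.exp (-(κ * (g.1 ^ 2 + g.2 ^ 2))) ∂((gaussianReal 0 1).prod (gaussianReal 0 1)) ≤
      1 / (2 * κ) := by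
  have h : ∀ g : ℝ × ℝ, Real.exp (-(κ * (g.1 ^ 2 + g.2 ^ 2))) =
      Real.exp (-(κ * g.1 ^ 2)) * Real.exp (-(κ * g.2 ^ 2)) := fun g => by
    rw [← Real.exp_add]; congr 1; ring
  simp_rw [h]
  rw [integral_prod_mul (fun x => Real.exp (-(κ * x ^ 2))) (fun x => Real.exp (-(κ * x ^ 2))),
    integral_exp_neg_mul_sq_gaussianReal]
  have hpi := Real.pi_pos
  rw [mul_mul_mul_comm, Real.mul_self_sqrt (by positivity), ← mul_inv,
    Real.mul_self_sqrt (by positivity), inv_mul_eq_div, div_div, mul_comm (κ + 1 / 2), mul_assoc,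
    mul_left_comm, mul_comm, div_le_div_iff₀ (by positivity) (by positivity)]
  nlinarith

lemma exp_neg_sq_div_two_eq_integral (v : ℝ) :
    (Real.exp (-(v ^ 2 / 2)) : ℂ) = ∫ g : ℝ, Complex.exp (v * g * Complex.I) ∂(gaussianReal 0 1) := by
  rw [← charFun_apply_real, charFun_gaussianReal]
  push_cast
  congr 1
  ring

variable {Ω : Type*} [MeasurableSpace Ω] {P : Measure Ω} [IsProbabilityMeasure P]

/-- Esseen-type small ball estimate with Gaussian smoothing. -/
lemma measureReal_abs_le_one_le_integral {W₁ W₂ : Ω → ℝ} (h₁ : Measurable W₁) (h₂ : Measurable W₂)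
    {B : ℝ × ℝ → ℝ} (hB : Integrable B ((gaussianReal 0 1).prod (gaussianReal 0 1)))
    (hle : ∀ g : ℝ × ℝ,
      ‖∫ ω, Complex.exp ((g.1 * W₁ ω + g.2 * W₂ ω : ℝ) * Complex.I) ∂P‖ ≤ B g) :
    P.real {ω | |W₁ ω| ≤ 1 ∧ |W₂ ω| ≤ 1} ≤
      Real.exp 1 * ∫ g, B g ∂((gaussianReal 0 1).prod (gaussianReal 0 1)) := by
  set γ := (gaussianReal 0 1).prod (gaussianReal 0 1)
  have hmeas : MeasurableSet {ω | |W₁ ω| ≤ 1 ∧ |W₂ ω| ≤ 1} :=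
    (measurableSet_le h₁.abs measurable_const).inter (measurableSet_le h₂.abs measurable_const)
  have hbd : ∀ ω, ‖Real.exp (-(W₁ ω ^ 2 / 2)) * Real.exp (-(W₂ ω ^ 2 / 2))‖ ≤ 1 := fun ω => by
    rw [← Real.exp_add, Real.norm_eq_abs, Real.abs_exp, Real.exp_le_one_iff]
    nlinarith [sq_nonneg (W₁ ω), sq_nonneg (W₂ ω)]
  have hint : Integrable
      (fun ω => Real.exp (-(W₁ ω ^ 2 / 2)) * Real.exp (-(W₂ ω ^ 2 / 2))) P :=
    Integrable.of_bound (C := 1) (by fun_prop) (Filter.Eventually.of_forall hbd)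
  -- On the event the Gaussian weight is at least exp(-1), which explains the factor e. Fubini then
  -- writes its mean as a Gaussian average of the characteristic function.
  have h1 : P.real {ω | |W₁ ω| ≤ 1 ∧ |W₂ ω| ≤ 1} ≤
      ∫ ω, Real.exp 1 * (Real.exp (-(W₁ ω ^ 2 / 2)) * Real.exp (-(W₂ ω ^ 2 / 2))) ∂P := by
    rw [← integral_indicator_one hmeas]
    refine integral_mono ((integrable_const _).indicator hmeas) (hint.const_mul _) fun ω => ?_
    by_cases hω : ω ∈ {ω | |W₁ ω| ≤ 1 ∧ |W₂ ω| ≤ 1}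
    swap
    · rw [Set.indicator_of_notMem hω]
      positivity
    rw [Set.indicator_of_mem hω, ← Real.exp_add, ← Real.exp_add, Pi.one_apply, Real.one_le_exp_iff]
    have h3 := (sq_le_one_iff_abs_le_one _).2 hω.1
    have h4 := (sq_le_one_iff_abs_le_one _).2 hω.2
    linarith
  have hswap : ((∫ ω, Real.exp (-(W₁ ω ^ 2 / 2)) * Real.exp (-(W₂ ω ^ 2 / 2)) ∂P : ℝ) : ℂ) =
      ∫ g, ∫ ω, Complex.exp ((g.1 * W₁ ω + g.2 * W₂ ω : ℝ) * Complex.I) ∂P ∂γ := by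
    rw [← integral_complex_ofReal, ← integral_integral_swap]
    · refine integral_congr_ae (Filter.Eventually.of_forall fun ω => ?_)
      simp only
      rw [Complex.ofReal_mul, exp_neg_sq_div_two_eq_integral, exp_neg_sq_div_two_eq_integral,
        ← integral_prod_mul]
      refine integral_congr_ae (Filter.Eventually.of_forall fun g => ?_)
      simp only
      rw [← Complex.exp_add]
      congr 1
      push_cast
      ring
    · refine Integrable.of_bound (C := 1) ?_ (Filter.Eventually.of_forall fun z => ?_)
      · refine Measurable.aestronglyMeasurable ?_
        simp only [Function.uncurry_def]
        fun_prop
      · simp only [Function.uncurry_def]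
        rw [Complex.norm_exp_ofReal_mul_I]
  rw [integral_const_mul] at h1
  refine h1.trans (mul_le_mul_of_nonneg_left ?_ (Real.exp_pos 1).le)
  calc _ ≤ ‖((∫ ω, Real.exp (-(W₁ ω ^ 2 / 2)) * Real.exp (-(W₂ ω ^ 2 / 2)) ∂P : ℝ) : ℂ)‖ := by
        rw [Complex.norm_real]; exact le_abs_self _
    _ ≤ ∫ g, ‖∫ ω, Complex.exp ((g.1 * W₁ ω + g.2 * W₂ ω : ℝ) * Complex.I) ∂P‖ ∂γ := by
        rw [hswap]; exact norm_integral_le_integral_norm _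
    _ ≤ ∫ g, B g ∂γ :=
        integral_mono_of_nonneg (Filter.Eventually.of_forall fun g => norm_nonneg _) hB
          (Filter.Eventually.of_forall hle)

lemma one_le_exp_neg_mul_sum_exp {L a b : ℝ} (h : 2 * L ^ 2 < a ^ 2 + b ^ 2) :
    1 ≤ Real.exp (-L) * (Real.exp a + Real.exp (-a) + Real.exp b + Real.exp (-b)) := by
  have h1 : L < |a| ∨ L < |b| := by
    by_contra! hc
    have := sq_le_sq' (by linarith [abs_nonneg a]) hc.1
    have := sq_le_sq' (by linarith [abs_nonneg b]) hc.2
    simp only [sq_abs] at *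
    linarith
  rw [Real.exp_neg, inv_mul_eq_div, one_le_div (Real.exp_pos _)]
  have := Real.exp_pos a
  have := Real.exp_pos (-a)
  have := Real.exp_pos b
  have := Real.exp_pos (-b)
  rcases h1 with h1 | h1 <;> rcases lt_abs.1 h1 with h2 | h2 <;>
    linarith [Real.exp_lt_exp.2 h2]

/-- Decay is needed only on a disc, since weak Cramer degrades at infinity. Outside it the trivial
bound 1 is absorbed by the exponential moments of the Gaussian, at cost exp(-L). -/
lemma measureReal_abs_le_one_le_of_decay {W₁ W₂ : Ω → ℝ} (h₁ : Measurable W₁) (h₂ : Measurable W₂)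
    {κ L D : ℝ} (hκ : 0 < κ) (hD : 0 ≤ D)
    (hle : ∀ u v : ℝ, u ^ 2 + v ^ 2 ≤ 2 * L ^ 2 →
      ‖∫ ω, Complex.exp ((u * W₁ ω + v * W₂ ω : ℝ) * Complex.I) ∂P‖ ≤
        Real.exp (-(κ * (u ^ 2 + v ^ 2))) + D) :
    P.real {ω | |W₁ ω| ≤ 1 ∧ |W₂ ω| ≤ 1} ≤
      Real.exp 1 * (1 / (2 * κ) + D + 8 * Real.exp (-L)) := by
  have hE : ∀ s : ℝ, ∫ x, Real.exp (s * x) ∂(gaussianReal 0 1) = Real.exp (s ^ 2 / 2) := fun s => by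
    have := congrFun (mgf_id_gaussianReal (μ := 0) (v := 1)) s
    simpa [mgf] using this
  have hEi := fun s => integrable_exp_mul_gaussianReal (μ := 0) (v := 1) s
  have hE1 := hE 1
  have hE2 := hE (-1)
  have hEi1 := hEi 1
  have hEi2 := hEi (-1)
  simp only [one_mul, neg_mul] at hE1 hE2 hEi1 hEi2
  norm_num at hE1 hE2
  have hi1 : Integrable (fun g : ℝ × ℝ => Real.exp (-(κ * (g.1 ^ 2 + g.2 ^ 2))))
      ((gaussianReal 0 1).prod (gaussianReal 0 1)) := by
    refine Integrable.of_bound (C := 1) (by fun_prop) (Filter.Eventually.of_forall fun x => ?_)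
    rw [Real.norm_eq_abs, Real.abs_exp]
    exact Real.exp_le_one_iff.2 (by
      nlinarith [mul_nonneg hκ.le (sq_nonneg x.1), mul_nonneg hκ.le (sq_nonneg x.2)])
  have a1 := hEi1.comp_fst (gaussianReal 0 1)
  have a2 := hEi2.comp_fst (gaussianReal 0 1)
  have a3 := hEi1.comp_snd (gaussianReal 0 1)
  have a4 := hEi2.comp_snd (gaussianReal 0 1)
  have hi2 : Integrable (fun g : ℝ × ℝ => Real.exp (-L) *
      (Real.exp g.1 + Real.exp (-g.1) + Real.exp g.2 + Real.exp (-g.2)))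
      ((gaussianReal 0 1).prod (gaussianReal 0 1)) :=
    (((a1.add a2).add a3).add a4).const_mul _
  have hi3 : Integrable (fun g : ℝ × ℝ => Real.exp (-(κ * (g.1 ^ 2 + g.2 ^ 2))) + D)
      ((gaussianReal 0 1).prod (gaussianReal 0 1)) := hi1.add (integrable_const D)
  have a12 : Integrable (fun g : ℝ × ℝ => Real.exp g.1 + Real.exp (-g.1))
      ((gaussianReal 0 1).prod (gaussianReal 0 1)) := a1.add a2
  have a123 : Integrable (fun g : ℝ × ℝ => Real.exp g.1 + Real.exp (-g.1) + Real.exp g.2)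
      ((gaussianReal 0 1).prod (gaussianReal 0 1)) := a12.add a3
  refine (measureReal_abs_le_one_le_integral h₁ h₂ (hi3.add hi2)
    fun g => ?_).trans (mul_le_mul_of_nonneg_left ?_ (Real.exp_pos 1).le)
  · simp only [Pi.add_apply]
    rcases le_or_gt (g.1 ^ 2 + g.2 ^ 2) (2 * L ^ 2) with h | h
    · refine (hle _ _ h).trans (le_add_of_nonneg_right (by positivity))
    · have h3 : ‖∫ ω, Complex.exp ((g.1 * W₁ ω + g.2 * W₂ ω : ℝ) * Complex.I) ∂P‖ ≤ 1 := by
        refine (norm_integral_le_of_norm_le_const (C := 1)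
          (Filter.Eventually.of_forall fun ω => ?_)).trans (by simp)
        rw [Complex.norm_exp_ofReal_mul_I]
      have h4 := one_le_exp_neg_mul_sum_exp h
      have h5 := Real.exp_pos (-(κ * (g.1 ^ 2 + g.2 ^ 2)))
      linarith
  · simp only [Pi.add_apply]
    have e1 : ∫ g, Real.exp g.1 ∂((gaussianReal 0 1).prod (gaussianReal 0 1)) = Real.exp (1 / 2) := by
      rw [integral_fun_fst (fun x => Real.exp x), hE1]; simp
    have e2 : ∫ g, Real.exp (-g.1) ∂((gaussianReal 0 1).prod (gaussianReal 0 1)) =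
        Real.exp (1 / 2) := by
      rw [integral_fun_fst (fun x => Real.exp (-x)), hE2]; simp
    have e3 : ∫ g, Real.exp g.2 ∂((gaussianReal 0 1).prod (gaussianReal 0 1)) = Real.exp (1 / 2) := by
      rw [integral_fun_snd (fun x => Real.exp x), hE1]; simp
    have e4 : ∫ g, Real.exp (-g.2) ∂((gaussianReal 0 1).prod (gaussianReal 0 1)) =
        Real.exp (1 / 2) := by
      rw [integral_fun_snd (fun x => Real.exp (-x)), hE2]; simp
    rw [integral_add hi3 hi2, integral_add hi1 (integrable_const D),
      integral_const_mul, integral_add a123 a4, integral_add a12 a3,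
      integral_add a1 a2, e1, e2, e3, e4]
    have h6 := integral_exp_neg_mul_sq_prod_gaussianReal_le hκ
    -- Four exponential moments, each at most 2, give the constant 8.
    have h7 : Real.exp (1 / 2) ≤ 2 := by
      have := Real.exp_one_lt_d9
      have h8 : Real.exp (1 / 2) * Real.exp (1 / 2) = Real.exp 1 := by
        rw [← Real.exp_add]; norm_num
      nlinarith [Real.exp_pos (1 / 2)]
    have h9 := Real.exp_pos (-L)
    simp only [integral_const, probReal_univ, smul_eq_mul, one_mul]
    nlinarith

end SmallBall

/-! ### Linear statistics of independent variables: Fourier decay and tails -/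

section LinearStatistic

open ProbabilityTheory

variable {Ω : Type*} [MeasurableSpace Ω] {P : Measure Ω} [IsProbabilityMeasure P]

omit [IsProbabilityMeasure P] in
lemma norm_integral_exp_sum_mul_I {ι : Type*} {Z : ι → Ω → ℝ} {ν : Measure ℝ}
    (hZ : ∀ i, Measurable (Z i)) (hind : iIndepFun Z P) (hlaw : ∀ i, P.map (Z i) = ν)
    (s : Finset ι) (c : ι → ℝ) :
    ‖∫ ω, Complex.exp ((∑ i ∈ s, c i * Z i ω : ℝ) * Complex.I) ∂P‖ =
      ∏ i ∈ s, ‖charFun ν (c i)‖ := by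
  have hm : ∀ i, Measurable fun ω => c i * Z i ω := fun i => (hZ i).const_mul _
  have hind' : iIndepFun (fun i ω => c i * Z i ω) P :=
    hind.comp (fun i z => c i * z) fun i => measurable_id.const_mul _
  have h1 := congrFun (iIndepFun.charFun_map_fun_finsetSum_eq_prod (s := s)
    (X := fun i ω => c i * Z i ω) (fun i _ => (hm i).aemeasurable) (hind'.restrict s)) 1
  rw [charFun_apply_real, integral_map (Finset.measurable_sum s fun i _ => hm i).aemeasurable
    (by fun_prop)] at h1
  simp only [Complex.ofReal_one, one_mul] at h1
  rw [h1, Finset.prod_apply, norm_prod]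
  refine Finset.prod_congr rfl fun i _ => ?_
  have h2 : P.map (fun ω => c i * Z i ω) = ν.map (fun z => c i * z) := by
    rw [← hlaw i, Measure.map_map (by fun_prop) (hZ i)]
    rfl
  rw [h2, charFun_map_mul, mul_one]

omit [IsProbabilityMeasure P] in
/-- Decay of the characteristic function of `∑ j, (c j * Z (inl j) + d j * Z (inr j))`, when
`c j ^ 2 + d j ^ 2` is under control for `j` in a subset `T` of the indices. -/
lemma norm_integral_exp_sum_pairs_le {Z : ℕ ⊕ ℕ → Ω → ℝ} {ν : Measure ℝ} [IsProbabilityMeasure ν]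
    (hZ : ∀ i, Measurable (Z i)) (hind : iIndepFun Z P) (hlaw : ∀ i, P.map (Z i) = ν)
    {A : ℝ} (n : ℕ) (c d : ℕ → ℝ) (T : Finset ℕ) (hT : T ⊆ Finset.range n)
    (hA : ∀ j ∈ T, ‖charFun ν (c j) * charFun ν (d j)‖ ≤ Real.exp (-A)) :
    ‖∫ ω, Complex.exp ((∑ j ∈ Finset.range n, (c j * Z (Sum.inl j) ω + d j * Z (Sum.inr j) ω) : ℝ)
      * Complex.I) ∂P‖ ≤ Real.exp (-(T.card * A)) := by
  have h := norm_integral_exp_sum_mul_I hZ hind hlaw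
    ((Finset.range n).disjSum (Finset.range n)) (Sum.elim c d)
  simp only [Finset.sum_disjSum, Finset.prod_disjSum, Sum.elim_inl, Sum.elim_inr] at h
  rw [← Finset.prod_mul_distrib] at h
  simp only [Finset.sum_add_distrib]
  rw [h, ← Finset.prod_sdiff hT, ← mul_neg, Real.exp_nat_mul]
  have h1 : ∏ j ∈ Finset.range n \ T, ‖charFun ν (c j)‖ * ‖charFun ν (d j)‖ ≤ 1 :=
    Finset.prod_le_one (fun j _ => by positivity) fun j _ =>
      mul_le_one₀ (norm_charFun_le_one _) (norm_nonneg _) (norm_charFun_le_one _)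
  have h2 : ∏ j ∈ T, ‖charFun ν (c j)‖ * ‖charFun ν (d j)‖ ≤ Real.exp (-A) ^ T.card := by
    rw [← Finset.prod_const]
    refine Finset.prod_le_prod (fun j _ => by positivity) fun j hj => ?_
    rw [← norm_mul]
    exact hA j hj
  exact (mul_le_of_le_one_left (Finset.prod_nonneg fun j _ => by positivity) h1).trans h2

/-- `z` if `|z| ≤ B`, and `0` otherwise. -/
noncomputable def truncAt (B z : ℝ) : ℝ := if |z| ≤ B then z else 0

lemma measurable_truncAt (B : ℝ) : Measurable (truncAt B) :=
  Measurable.ite (measurableSet_le measurable_id.abs measurable_const) measurable_id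
    measurable_const

/-- The right side keeps the untruncated z, so its mean is exact and truncation needs no
recentering. Where z is cut off, the left side is 1 and |az| ≤ |z|/B ≤ z²/B². -/
lemma exp_mul_truncAt_le {B a z : ℝ} (hB : 0 < B) (ha : |a| ≤ 1 / B) :
    Real.exp (a * truncAt B z) ≤ 1 + a * z + z ^ 2 / B ^ 2 := by
  have h1 : |a| * |z| ≤ |z| / B := by
    calc |a| * |z| ≤ 1 / B * |z| := by gcongr
      _ = |z| / B := by ring
  unfold truncAt
  split_ifs with hz
  · have h2 : |a * z| ≤ 1 := by
      rw [abs_mul]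
      exact h1.trans ((div_le_one hB).2 hz)
    have h3 := (abs_le.1 (Real.abs_exp_sub_one_sub_id_le h2)).2
    have h4 : (a * z) ^ 2 ≤ z ^ 2 / B ^ 2 := by
      rw [← div_pow]
      refine sq_le_sq.2 ?_
      rwa [abs_mul, abs_div, abs_of_pos hB]
    linarith
  · push Not at hz
    have h5 : |z| / B ≤ z ^ 2 / B ^ 2 := by
      rw [← sq_abs, div_le_div_iff₀ hB (by positivity)]
      have : B * (|z| * B) ≤ |z| * (|z| * B) := by gcongr
      nlinarith
    have h6 := neg_abs_le (a * z)
    rw [abs_mul] at h6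
    simp
    linarith

lemma mgf_mul_truncAt_le {X : Ω → ℝ} (hXi : Integrable X P)
    (hX2 : Integrable (fun ω => X ω ^ 2) P) (hmean : ∫ ω, X ω ∂P = 0)
    (hvar : ∫ ω, X ω ^ 2 ∂P = 1) {B a : ℝ} (hB : 0 < B) (ha : |a| ≤ 1 / B) :
    mgf (fun ω => a * truncAt B (X ω)) P 1 ≤ Real.exp (1 / B ^ 2) := by
  unfold mgf
  simp only [one_mul]
  have hI₁ : Integrable (fun ω => 1 + a * X ω) P := (integrable_const _).add (hXi.const_mul a)
  have hI : Integrable (fun ω => 1 + a * X ω + X ω ^ 2 / B ^ 2) P := hI₁.add (hX2.div_const _)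
  calc _ ≤ ∫ ω, (1 + a * X ω + X ω ^ 2 / B ^ 2) ∂P := by
        refine integral_mono_of_nonneg (Filter.Eventually.of_forall fun ω => (Real.exp_pos _).le) hI
          (Filter.Eventually.of_forall fun ω => exp_mul_truncAt_le hB ha)
    _ = 1 + 1 / B ^ 2 := by
        rw [integral_add hI₁ (hX2.div_const _),
          integral_add (integrable_const _) (hXi.const_mul a), integral_const_mul,
          integral_div, hmean, hvar]
        simp
    _ ≤ _ := by linarith [Real.add_one_le_exp (1 / B ^ 2)]

/-- Chernoff's bound at parameter 1. For B = √n and 2n variables the first factor is the constant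
e². -/
lemma measureReal_le_sum_truncAt_le {ι : Type*} {Z : ι → Ω → ℝ}
    (hZ : ∀ i, Measurable (Z i)) (hind : iIndepFun Z P) (hZi : ∀ i, Integrable (Z i) P)
    (hZ2 : ∀ i, Integrable (fun ω => Z i ω ^ 2) P) (hmean : ∀ i, ∫ ω, Z i ω ∂P = 0)
    (hvar : ∀ i, ∫ ω, Z i ω ^ 2 ∂P = 1) {B : ℝ} (hB : 0 < B) (s : Finset ι) {c : ι → ℝ}
    (hc : ∀ i, |c i| ≤ 1 / B) (r : ℝ) :
    P.real {ω | r ≤ ∑ i ∈ s, c i * truncAt B (Z i ω)} ≤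
      Real.exp (s.card / B ^ 2) * Real.exp (-r) := by
  have hm : ∀ i, Measurable fun ω => c i * truncAt B (Z i ω) := fun i =>
    ((measurable_truncAt B).comp (hZ i)).const_mul _
  have hind' : iIndepFun (fun i ω => c i * truncAt B (Z i ω)) P :=
    hind.comp (fun i z => c i * truncAt B z) fun i => (measurable_truncAt B).const_mul _
  have hbd : ∀ i ω, |c i * truncAt B (Z i ω)| ≤ 1 := fun i ω => by
    have h1 : |truncAt B (Z i ω)| ≤ B := by
      unfold truncAt
      split_ifs with h
      · exact h
      · simpa using hB.le
    rw [abs_mul]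
    calc |c i| * |truncAt B (Z i ω)| ≤ 1 / B * B := by gcongr; exact hc i
      _ = 1 := by field_simp
  have hint : Integrable (fun ω => Real.exp (1 * ∑ i ∈ s, c i * truncAt B (Z i ω))) P := by
    refine Integrable.of_bound (C := Real.exp s.card) (Measurable.aestronglyMeasurable
      (((Finset.measurable_sum s fun i _ => hm i).const_mul _).exp))
      (Filter.Eventually.of_forall fun ω => ?_)
    rw [Real.norm_eq_abs, Real.abs_exp, one_mul, Real.exp_le_exp]
    calc _ ≤ ∑ i ∈ s, (1 : ℝ) := Finset.sum_le_sum fun i _ => (le_abs_self _).trans (hbd i ω)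
      _ = s.card := by simp
  refine (measure_ge_le_exp_mul_mgf r zero_le_one hint).trans ?_
  have h2 : mgf (fun ω => ∑ i ∈ s, c i * truncAt B (Z i ω)) P 1 ≤ Real.exp (s.card / B ^ 2) := by
    have h3 : (fun ω => ∑ i ∈ s, c i * truncAt B (Z i ω)) =
        ∑ i ∈ s, fun ω => c i * truncAt B (Z i ω) := by
      ext ω; simp
    rw [h3, hind'.mgf_sum hm]
    calc _ ≤ ∏ i ∈ s, Real.exp (1 / B ^ 2) :=
          Finset.prod_le_prod (fun i _ => mgf_nonneg) fun i _ =>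
            mgf_mul_truncAt_le (hZi i) (hZ2 i) (hmean i) (hvar i) hB (hc i)
      _ = _ := by
        rw [Finset.prod_const, ← Real.exp_nat_mul]
        congr 1
        ring
  rw [neg_one_mul, mul_comm]
  gcongr

/-- Tail bound for a linear statistic on the event that none of its variables exceeds `√n`. -/
lemma measureReal_le_abs_sum_pairs_le {Z : ℕ ⊕ ℕ → Ω → ℝ}
    (hZ : ∀ i, Measurable (Z i)) (hind : iIndepFun Z P) (hZi : ∀ i, Integrable (Z i) P)
    (hZ2 : ∀ i, Integrable (fun ω => Z i ω ^ 2) P) (hmean : ∀ i, ∫ ω, Z i ω ∂P = 0)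
    (hvar : ∀ i, ∫ ω, Z i ω ^ 2 ∂P = 1) {n : ℕ} (hn : 1 ≤ n) {c d : ℕ → ℝ}
    (hc : ∀ j, |c j| ≤ 1 / √(n : ℝ)) (hd : ∀ j, |d j| ≤ 1 / √(n : ℝ)) (r : ℝ) :
    P.real {ω | (∀ j < n, |Z (Sum.inl j) ω| ≤ √(n : ℝ) ∧ |Z (Sum.inr j) ω| ≤ √(n : ℝ)) ∧
      r ≤ |∑ j ∈ Finset.range n, (c j * Z (Sum.inl j) ω + d j * Z (Sum.inr j) ω)|} ≤
      2 * Real.exp (2 - r) := by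
  have hn0 : (0 : ℝ) < n := by exact_mod_cast hn
  have hB : 0 < √(n : ℝ) := Real.sqrt_pos.2 hn0
  set s := (Finset.range n).disjSum (Finset.range n) with hs
  have hcard : (s.card : ℝ) / √(n : ℝ) ^ 2 = 2 := by
    rw [hs, Finset.card_disjSum, Finset.card_range, Real.sq_sqrt hn0.le]
    push_cast
    field_simp
    norm_num
  have key : ∀ e : ℕ ⊕ ℕ → ℝ, (∀ i, |e i| ≤ 1 / √(n : ℝ)) →
      P.real {ω | r ≤ ∑ i ∈ s, e i * truncAt (√(n : ℝ)) (Z i ω)} ≤ Real.exp (2 - r) := fun e he => by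
    have := measureReal_le_sum_truncAt_le hZ hind hZi hZ2 hmean hvar hB s he r
    rwa [hcard, ← Real.exp_add, ← sub_eq_add_neg] at this
  have he : ∀ i, |Sum.elim c d i| ≤ 1 / √(n : ℝ) := by
    rintro (j | j)
    · exact hc j
    · exact hd j
  have h1 := key (Sum.elim c d) he
  have h2 := key (fun i => -Sum.elim c d i) fun i => by rw [abs_neg]; exact he i
  rw [two_mul]
  refine le_trans ?_ (add_le_add h1 h2)
  refine le_trans (measureReal_mono ?_) (measureReal_union_le _ _)
  rintro ω ⟨hω, hr⟩
  have h3 : ∑ i ∈ s, Sum.elim c d i * truncAt (√(n : ℝ)) (Z i ω) =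
      ∑ j ∈ Finset.range n, (c j * Z (Sum.inl j) ω + d j * Z (Sum.inr j) ω) := by
    rw [hs, Finset.sum_disjSum, Finset.sum_add_distrib]
    congr 1 <;> refine Finset.sum_congr rfl fun j hj => ?_
    · simp [truncAt, (hω j (Finset.mem_range.1 hj)).1]
    · simp [truncAt, (hω j (Finset.mem_range.1 hj)).2]
  rcases le_abs.1 hr with h | h
  · left
    rwa [Set.mem_ofPred_eq, h3]
  · right
    simp only [Set.mem_ofPred_eq, neg_mul, Finset.sum_neg_distrib]
    rwa [h3]

lemma measureReal_exists_lt_abs_le {ι : Type*} {Z : ι → Ω → ℝ} {q : ℕ} {M B : ℝ} (hB : 0 < B)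
    (hZq : ∀ i, Integrable (fun ω => |Z i ω| ^ q) P) (hM : ∀ i, ∫ ω, |Z i ω| ^ q ∂P = M)
    (s : Finset ι) :
    P.real {ω | ∃ i ∈ s, B < |Z i ω|} ≤ s.card * (M / B ^ q) := by
  have h1 : {ω | ∃ i ∈ s, B < |Z i ω|} = ⋃ i ∈ s, {ω | B < |Z i ω|} := by
    ext ω; simp
  rw [h1]
  refine (measureReal_biUnion_finset_le s _).trans ?_
  calc _ ≤ ∑ i ∈ s, M / B ^ q := by
        refine Finset.sum_le_sum fun i _ => ?_
        rw [le_div_iff₀ (by positivity), mul_comm, ← hM i]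
        refine le_trans ?_ (mul_meas_ge_le_integral_of_nonneg
          (Filter.Eventually.of_forall fun ω => by positivity) (hZq i) (B ^ q))
        refine mul_le_mul_of_nonneg_left (measureReal_mono fun ω hω => ?_) (by positivity)
        exact pow_le_pow_left₀ hB.le (le_of_lt hω) q
    _ = _ := by simp

end LinearStatistic

/-! ### Derivatives of the polynomial and passage to a grid -/

section TrigPoly

/-- Differentiation stays within the family, with new weights k/n ≤ 1, so iteration also yields the
second and third derivatives. -/
lemma hasDerivAt_trigPoly (x y φ : ℕ → ℝ) (n : ℕ) (t : ℝ) :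
    HasDerivAt (trigPoly x y φ n)
      (trigPoly (fun k => k / n * y k) (fun k => -(k / n * x k)) φ n t) t := by
  unfold trigPoly
  refine HasDerivAt.const_mul _ (HasDerivAt.fun_sum fun k _ => ?_)
  have h : HasDerivAt (fun t : ℝ => k * t / n + φ k) ((k : ℝ) / n) t := by
    simpa using (((hasDerivAt_id t).const_mul (k : ℝ)).div_const (n : ℝ)).add_const (φ k)
  convert! (h.cos.const_mul (x k)).add (h.sin.const_mul (y k)) using 1
  ring

lemma trigPoly_eq_sum_range (x y φ : ℕ → ℝ) (n : ℕ) (t : ℝ) :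
    trigPoly x y φ n t = ∑ j ∈ Finset.range n,
      (Real.cos ((j + 1 : ℕ) * t / n + φ (j + 1)) / √(n : ℝ) * x (j + 1) +
        Real.sin ((j + 1 : ℕ) * t / n + φ (j + 1)) / √(n : ℝ) * y (j + 1)) := by
  have h : Finset.Icc 1 n = Finset.Ico (0 + 1) (n + 1) := by ext; simp
  unfold trigPoly
  rw [h, ← Finset.sum_Ico_add' _ 0 n 1, ← Finset.range_eq_Ico, Finset.mul_sum]
  refine Finset.sum_congr rfl fun j _ => ?_
  ring

lemma abs_trigPoly_le {x y φ : ℕ → ℝ} {n : ℕ} {B : ℝ}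
    (hx : ∀ k ∈ Finset.Icc 1 n, |x k| ≤ B) (hy : ∀ k ∈ Finset.Icc 1 n, |y k| ≤ B) (t : ℝ) :
    |trigPoly x y φ n t| ≤ 2 * √(n : ℝ) * B := by
  unfold trigPoly
  rw [abs_mul, abs_of_nonneg (by positivity)]
  have h : |∑ k ∈ Finset.Icc 1 n,
      (x k * Real.cos (k * t / n + φ k) + y k * Real.sin (k * t / n + φ k))| ≤ n * (2 * B) := by
    calc _ ≤ ∑ k ∈ Finset.Icc 1 n, (2 * B) := by
          refine (Finset.abs_sum_le_sum_abs _ _).trans (Finset.sum_le_sum fun k hk => ?_)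
          refine (abs_add_le _ _).trans ?_
          rw [abs_mul, abs_mul]
          have h1 := mul_le_of_le_one_right (abs_nonneg (x k)) (Real.abs_cos_le_one (k * t / n + φ k))
          have h2 := mul_le_of_le_one_right (abs_nonneg (y k)) (Real.abs_sin_le_one (k * t / n + φ k))
          linarith [hx k hk, hy k hk]
      _ = n * (2 * B) := by simp
  calc _ ≤ 1 / √(n : ℝ) * (n * (2 * B)) := by gcongr
    _ = 2 * (n / √(n : ℝ)) * B := by ring
    _ = _ := by rw [Real.div_sqrt]

lemma abs_sub_le_of_hasDerivAt {f f' : ℝ → ℝ} (hf : ∀ r, HasDerivAt f (f' r) r) {C s t : ℝ}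
    (hC : ∀ r ∈ Set.uIcc s t, |f' r| ≤ C) : |f t - f s| ≤ C * |t - s| :=
  (convex_uIcc s t).norm_image_sub_le_of_norm_hasDerivWithin_le
    (fun r _ => (hf r).hasDerivWithinAt) hC Set.left_mem_uIcc Set.right_mem_uIcc

/-- A near-zero of `f` and `f'` at `t` propagates to a nearby point `s` at which `f''` is
controlled. -/
lemma abs_le_and_abs_deriv_le_of_near {f f₁ f₂ f₃ : ℝ → ℝ} (h₀ : ∀ r, HasDerivAt f (f₁ r) r)
    (h₁ : ∀ r, HasDerivAt f₁ (f₂ r) r) (h₂ : ∀ r, HasDerivAt f₂ (f₃ r) r) {δ l K s t : ℝ}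
    (hδ : δ ≤ 1) (hK : 0 ≤ K) (hδK : K * δ ≤ 2) (h₃ : ∀ r, |f₃ r| ≤ K) (hst : |t - s| ≤ δ)
    (ht : |f t| + |f₁ t| < δ) (hs : |f₂ s| ≤ l) :
    |f s| ≤ δ * (l + 4) ∧ |f₁ s| ≤ δ * (l + 4) := by
  have hδ0 : 0 ≤ δ := (abs_nonneg _).trans hst
  have hl : 0 ≤ l := (abs_nonneg _).trans hs
  have hdist : ∀ r ∈ Set.uIcc s t, |r - s| ≤ δ ∧ |t - r| ≤ δ := fun r hr =>
    ⟨(Set.abs_sub_left_of_mem_uIcc hr).trans hst, (Set.abs_sub_right_of_mem_uIcc hr).trans hst⟩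
  have e2 : ∀ r ∈ Set.uIcc s t, |f₂ r| ≤ l + 2 := fun r hr => by
    have h := abs_sub_le_of_hasDerivAt h₂ (s := s) (t := r) (C := K) fun u _ => h₃ u
    have h' : K * |r - s| ≤ K * δ := mul_le_mul_of_nonneg_left (hdist r hr).1 hK
    have := abs_sub_abs_le_abs_sub (f₂ r) (f₂ s)
    linarith
  have e1 : ∀ r ∈ Set.uIcc s t, |f₁ r| ≤ δ * (l + 3) := fun r hr => by
    have h := abs_sub_le_of_hasDerivAt h₁ (s := r) (t := t) (C := l + 2) fun u hu =>
      e2 u (Set.uIcc_subset_uIcc_right hr hu)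
    have h' : (l + 2) * |t - r| ≤ (l + 2) * δ :=
      mul_le_mul_of_nonneg_left (hdist r hr).2 (by linarith)
    have := abs_sub_abs_le_abs_sub (f₁ r) (f₁ t)
    rw [abs_sub_comm] at this
    linarith [abs_nonneg (f t)]
  have h := abs_sub_le_of_hasDerivAt h₀ (s := s) (t := t) (C := δ * (l + 3)) e1
  have h' : δ * (l + 3) * |t - s| ≤ δ * (l + 3) * 1 :=
    mul_le_mul_of_nonneg_left (hst.trans hδ) (by positivity)
  have h'' := abs_sub_abs_le_abs_sub (f s) (f t)
  rw [abs_sub_comm] at h''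
  refine ⟨by linarith [abs_nonneg (f₁ t)], (e1 s Set.left_mem_uIcc).trans ?_⟩
  linarith

lemma exists_natCast_mul_near {a b δ t : ℝ} (hδ : 0 < δ) (ht : t ∈ Set.Icc a b) :
    ∃ j ∈ Finset.range (⌊(b - a) / δ⌋₊ + 1), |t - (a + j * δ)| ≤ δ := by
  have h0 : 0 ≤ (t - a) / δ := div_nonneg (by linarith [ht.1]) hδ.le
  refine ⟨⌊(t - a) / δ⌋₊, ?_, ?_⟩
  · rw [Finset.mem_range, Nat.lt_succ_iff]
    refine Nat.floor_le_floor ?_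
    gcongr
    exact ht.2
  · have h1 := Nat.floor_le h0
    have h2 := Nat.lt_floor_add_one ((t - a) / δ)
    rw [le_div_iff₀ hδ] at h1
    rw [div_lt_iff₀ hδ] at h2
    rw [abs_le]
    constructor <;> linarith

/-- The trivial bound is spent only on the third derivative, where 2n·δ ≤ 2 is harmless. The second
derivative is left as an alternative, to be excluded in probability at grid points. -/
lemma exists_grid_point_of_infAbsAddAbsDeriv_lt {x y φ : ℕ → ℝ} {n : ℕ} {a b δ ε l : ℝ}
    (hab : a ≤ b) (hδ0 : 0 < δ) (hδ : δ ≤ 1) (hnδ : n * δ ≤ 1) (hεδ : ε ≤ δ)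
    (hx : ∀ k ∈ Finset.Icc 1 n, |x k| ≤ √(n : ℝ)) (hy : ∀ k ∈ Finset.Icc 1 n, |y k| ≤ √(n : ℝ))
    (hinf : infAbsAddAbsDeriv (trigPoly x y φ n) a b < ε) :
    ∃ j ∈ Finset.range (⌊(b - a) / δ⌋₊ + 1),
      l ≤ |trigPoly (fun k => k / n * -(k / n * x k)) (fun k => -(k / n * (k / n * y k))) φ n
        (a + j * δ)| ∨
      (|trigPoly x y φ n (a + j * δ)| ≤ δ * (l + 4) ∧
        |trigPoly (fun k => k / n * y k) (fun k => -(k / n * x k)) φ n (a + j * δ)| ≤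
          δ * (l + 4)) := by
  have : Nonempty (Set.Icc a b) := ⟨⟨a, Set.left_mem_Icc.2 hab⟩⟩
  obtain ⟨⟨t, ht⟩, hlt⟩ := exists_lt_of_ciInf_lt hinf
  simp only [(hasDerivAt_trigPoly x y φ n t).deriv] at hlt
  obtain ⟨j, hj, hdist⟩ := exists_natCast_mul_near hδ0 ht
  refine ⟨j, hj, or_iff_not_imp_left.2 fun hl => ?_⟩
  have hk : ∀ k ∈ Finset.Icc 1 n, (k : ℝ) / n ≤ 1 := fun k hk =>
    div_le_one_of_le₀ (by exact_mod_cast (Finset.mem_Icc.1 hk).2) (by positivity)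
  have hmul : ∀ (k : ℕ) (z : ℝ), k ∈ Finset.Icc 1 n → |(k : ℝ) / n * z| ≤ |z| := fun k z h => by
    rw [abs_mul, abs_of_nonneg (by positivity : (0 : ℝ) ≤ k / n)]
    exact mul_le_of_le_one_left (abs_nonneg _) (hk k h)
  refine abs_le_and_abs_deriv_le_of_near (hasDerivAt_trigPoly x y φ n) (hasDerivAt_trigPoly _ _ φ n)
    (hasDerivAt_trigPoly _ _ φ n) hδ (K := 2 * n) (by positivity) (by linarith) (fun r => ?_) hdist
    (hlt.trans_le hεδ) (le_of_not_ge hl)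
  refine (abs_trigPoly_le (B := √(n : ℝ)) (fun k hk => ?_) (fun k hk => ?_) r).trans_eq ?_
  · refine (hmul k _ hk).trans ?_
    rw [abs_neg]
    exact (hmul k _ hk).trans ((hmul k _ hk).trans (hy k hk))
  · rw [abs_neg]
    refine (hmul k _ hk).trans ((hmul k _ hk).trans ?_)
    rw [abs_neg]
    exact (hmul k _ hk).trans (hx k hk)
  · rw [mul_assoc, Real.mul_self_sqrt (by positivity)]

end TrigPoly

/-! ### Bounds in probability for fixed n -/

section NonAsymptotic

open ProbabilityTheory

/-- The family of the `x (j + 1)` and `y (j + 1)`, `j : ℕ`. -/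
def coeffFamily {Ω : Type*} (x y : ℕ → Ω → ℝ) : ℕ ⊕ ℕ → Ω → ℝ :=
  Sum.elim (fun j => x (j + 1)) (fun j => y (j + 1))

lemma half_le_card_filter_range (n : ℕ) :
    (n : ℝ) / 2 ≤ ((Finset.range n).filter fun j => n ≤ 2 * (j + 1)).card := by
  have h : Finset.Ico (n / 2) n ⊆ (Finset.range n).filter fun j => n ≤ 2 * (j + 1) := by
    intro j hj
    rw [Finset.mem_Ico] at hj
    rw [Finset.mem_filter, Finset.mem_range]
    omega
  have h1 := Finset.card_le_card h
  rw [Nat.card_Ico] at h1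
  have h2 : n ≤ 2 * ((Finset.range n).filter fun j => n ≤ 2 * (j + 1)).card := by omega
  have h3 : (n : ℝ) ≤ 2 * ((Finset.range n).filter fun j => n ≤ 2 * (j + 1)).card := by
    exact_mod_cast h2
  linarith

variable {Ω : Type*} [MeasurableSpace Ω] {P : Measure Ω} [IsProbabilityMeasure P]
  {x y : ℕ → Ω → ℝ}

lemma measurable_trigPoly (hZ : ∀ i, Measurable (coeffFamily x y i)) (a b φ : ℕ → ℝ) (n : ℕ)
    (t : ℝ) : Measurable fun ω => trigPoly (fun k => a k * x k ω) (fun k => b k * y k ω) φ n t := by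
  simp only [trigPoly_eq_sum_range]
  refine Finset.measurable_sum _ fun j _ => ?_
  have h1 : Measurable (x (j + 1)) := hZ (Sum.inl j)
  have h2 : Measurable (y (j + 1)) := hZ (Sum.inr j)
  fun_prop

lemma measurable_trigPoly_swap (hZ : ∀ i, Measurable (coeffFamily x y i)) (a b φ : ℕ → ℝ) (n : ℕ)
    (t : ℝ) : Measurable fun ω => trigPoly (fun k => a k * y k ω) (fun k => b k * x k ω) φ n t := by
  simp only [trigPoly_eq_sum_range]
  refine Finset.measurable_sum _ fun j _ => ?_
  have h1 : Measurable (x (j + 1)) := hZ (Sum.inl j)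
  have h2 : Measurable (y (j + 1)) := hZ (Sum.inr j)
  fun_prop

/-- Small ball estimate for the pair `(U_n(t), U_n'(t))`. -/
lemma measureReal_abs_trigPoly_le {ν : Measure ℝ} [IsProbabilityMeasure ν]
    (hZ : ∀ i, Measurable (coeffFamily x y i)) (hind : iIndepFun (coeffFamily x y) P)
    (hlaw : ∀ i, P.map (coeffFamily x y i) = ν) {κ b : ℝ} (hκ : 0 < κ)
    (hdec : ∀ s t r₁ r₂ : ℝ, r₁ ≤ s ^ 2 + t ^ 2 → s ^ 2 + t ^ 2 ≤ r₂ →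
      ‖charFun ν s * charFun ν t‖ ≤ Real.exp (-(κ * min r₁ (r₂ ^ (-(b / 2))))))
    {n : ℕ} (hn : 1 ≤ n) (φ : ℕ → ℝ) (t : ℝ) {η L : ℝ} (hη : 0 < η) :
    P.real {ω | |trigPoly (fun k => x k ω) (fun k => y k ω) φ n t| ≤ η ∧
      |trigPoly (fun k => k / n * y k ω) (fun k => -(k / n * x k ω)) φ n t| ≤ η} ≤
      Real.exp 1 * (4 * η ^ 2 / κ +
        Real.exp (-(n / 2 * (κ * (2 * L ^ 2 / (η ^ 2 * n)) ^ (-(b / 2))))) +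
        8 * Real.exp (-L)) := by
  have hn0 : (0 : ℝ) < n := by exact_mod_cast hn
  set U : Ω → ℝ := fun ω => trigPoly (fun k => x k ω) (fun k => y k ω) φ n t with hU
  set V : Ω → ℝ := fun ω => trigPoly (fun k => k / n * y k ω) (fun k => -(k / n * x k ω)) φ n t
    with hV
  have hUm : Measurable U := by
    simpa using measurable_trigPoly hZ (fun _ => 1) (fun _ => 1) φ n t
  have hVm : Measurable V := by
    simpa using measurable_trigPoly_swap hZ (fun k => k / n) (fun k => -(k / n)) φ n t
  have hset : {ω | |U ω| ≤ η ∧ |V ω| ≤ η} = {ω | |U ω / η| ≤ 1 ∧ |V ω / η| ≤ 1} := by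
    ext ω
    simp only [Set.mem_ofPred_eq, abs_div, abs_of_pos hη, div_le_one hη]
  rw [hset]
  have h4 : 4 * η ^ 2 / κ = 1 / (2 * (κ / (8 * η ^ 2))) := by
    field_simp
    norm_num
  rw [h4]
  refine measureReal_abs_le_one_le_of_decay (hUm.div_const _) (hVm.div_const _) (by positivity)
    (Real.exp_pos _).le fun u v huv => ?_
  set ψ : ℕ → ℝ := fun j => (j + 1 : ℕ) * t / n + φ (j + 1) with hψ
  set r : ℕ → ℝ := fun j => ((j + 1 : ℕ) : ℝ) / n with hr
  set c : ℕ → ℝ := fun j => (u * Real.cos (ψ j) - v * r j * Real.sin (ψ j)) / (η * √(n : ℝ)) with hc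
  set d : ℕ → ℝ := fun j => (u * Real.sin (ψ j) + v * r j * Real.cos (ψ j)) / (η * √(n : ℝ)) with hd
  -- The pair (c j, d j) is a rotation by ψ j of (u, v r_j), up to scale, so t and the phases
  -- disappear.
  have hcd : ∀ j, c j ^ 2 + d j ^ 2 = (u ^ 2 + v ^ 2 * r j ^ 2) / (η ^ 2 * n) := fun j => by
    simp only [hc, hd]
    rw [div_pow, div_pow, ← add_div, mul_pow, Real.sq_sqrt hn0.le]
    congr 1
    linear_combination (u ^ 2 + v ^ 2 * r j ^ 2) * Real.sin_sq_add_cos_sq (ψ j)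
  have hsum : ∀ ω, u * (U ω / η) + v * (V ω / η) = ∑ j ∈ Finset.range n,
      (c j * coeffFamily x y (Sum.inl j) ω + d j * coeffFamily x y (Sum.inr j) ω) := fun ω => by
    simp only [hU, hV, trigPoly_eq_sum_range]
    rw [Finset.sum_div, Finset.sum_div, Finset.mul_sum, Finset.mul_sum, ← Finset.sum_add_distrib]
    refine Finset.sum_congr rfl fun j _ => ?_
    simp only [coeffFamily, Sum.elim_inl, Sum.elim_inr, hc, hd, hψ, hr]
    field_simp
    ring
  simp_rw [hsum]
  set A := κ * min ((u ^ 2 + v ^ 2) / (4 * (η ^ 2 * n))) ((2 * L ^ 2 / (η ^ 2 * n)) ^ (-(b / 2)))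
    with hA
  have hρ : 0 ≤ (2 * L ^ 2 / (η ^ 2 * n)) ^ (-(b / 2)) := by positivity
  have hA0 : 0 ≤ A := mul_nonneg hκ.le (le_min (by positivity) hρ)
  -- Only indices with r_j ≥ 1/2 are kept, at least n/2 of them: there u² + v² r_j² ≥ (u² + v²)/4.
  refine (norm_integral_exp_sum_pairs_le (A := A) hZ hind hlaw n c d
    ((Finset.range n).filter fun j => n ≤ 2 * (j + 1)) (Finset.filter_subset _ _)
    fun j hj => hdec _ _ _ _ ?_ ?_).trans ?_
  · rw [hcd, div_le_div_iff₀ (by positivity) (by positivity)]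
    have hj' : (n : ℝ) ≤ 2 * (j + 1 : ℕ) := by exact_mod_cast (Finset.mem_filter.1 hj).2
    have h1 : 1 / 2 ≤ r j := by
      simp only [hr]
      rw [div_le_div_iff₀ two_pos hn0]
      linarith
    have h2 : 1 ≤ 4 * r j ^ 2 := by nlinarith
    have h3 : u ^ 2 + v ^ 2 ≤ 4 * (u ^ 2 + v ^ 2 * r j ^ 2) := by
      nlinarith [sq_nonneg u, mul_le_mul_of_nonneg_left h2 (sq_nonneg v)]
    have h5 : 0 < η ^ 2 * n := by positivity
    nlinarith
  · rw [hcd]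
    have hj' : ((j + 1 : ℕ) : ℝ) ≤ n := by
      exact_mod_cast Finset.mem_range.1 (Finset.mem_filter.1 hj).1
    have h1 : r j ≤ 1 := div_le_one_of_le₀ hj' hn0.le
    have h2 : 0 ≤ r j := by positivity
    have h3 : r j ^ 2 ≤ 1 := pow_le_one₀ h2 h1
    have h5 := mul_le_mul_of_nonneg_left h3 (sq_nonneg v)
    gcongr
    linarith
  · have hcard := half_le_card_filter_range n
    have h1 := mul_le_mul_of_nonneg_right hcard hA0
    -- The first case gives the Gaussian term, as (n/2)·κ/(4η²n) = κ/(8η²); the second gives the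
    -- constant error.
    rcases min_cases ((u ^ 2 + v ^ 2) / (4 * (η ^ 2 * n)))
      ((2 * L ^ 2 / (η ^ 2 * n)) ^ (-(b / 2))) with ⟨h, -⟩ | ⟨h, -⟩
    · refine le_add_of_le_of_nonneg (Real.exp_le_exp.2 (neg_le_neg (le_trans (le_of_eq ?_) h1)))
        (Real.exp_pos _).le
      rw [hA, h]
      field_simp
      ring
    · refine le_add_of_nonneg_of_le (Real.exp_pos _).le
        (Real.exp_le_exp.2 (neg_le_neg (le_trans (le_of_eq ?_) h1)))
      rw [hA, h]

lemma measureReal_trigPoly_deriv_deriv_le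
    (hZ : ∀ i, Measurable (coeffFamily x y i)) (hind : iIndepFun (coeffFamily x y) P)
    (hZi : ∀ i, Integrable (coeffFamily x y i) P)
    (hZ2 : ∀ i, Integrable (fun ω => coeffFamily x y i ω ^ 2) P)
    (hmean : ∀ i, ∫ ω, coeffFamily x y i ω ∂P = 0)
    (hvar : ∀ i, ∫ ω, coeffFamily x y i ω ^ 2 ∂P = 1) {n : ℕ} (hn : 1 ≤ n) (φ : ℕ → ℝ) (t l : ℝ) :
    P.real {ω | (∀ j < n, |x (j + 1) ω| ≤ √(n : ℝ) ∧ |y (j + 1) ω| ≤ √(n : ℝ)) ∧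
      l ≤ |trigPoly (fun k => k / n * -(k / n * x k ω)) (fun k => -(k / n * (k / n * y k ω))) φ n t|}
      ≤ 2 * Real.exp (2 - l) := by
  set ψ : ℕ → ℝ := fun j => (j + 1 : ℕ) * t / n + φ (j + 1) with hψ
  -- The value 0 beyond n makes the weight bound hold for every index, as the tail lemma demands.
  set r : ℕ → ℝ := fun j => if j < n then ((j + 1 : ℕ) : ℝ) / n else 0 with hr
  have hr1 : ∀ j, |r j ^ 2| ≤ 1 := fun j => by
    have h0 : 0 ≤ r j := by simp only [hr]; positivity
    rw [abs_of_nonneg (sq_nonneg _)]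
    refine pow_le_one₀ h0 ?_
    simp only [hr]
    split_ifs with h
    · exact div_le_one_of_le₀ (by exact_mod_cast h) (by positivity)
    · exact zero_le_one
  have hbd : ∀ j e, |e| ≤ 1 → |-(r j ^ 2 * e / √(n : ℝ))| ≤ 1 / √(n : ℝ) := fun j e he => by
    rw [abs_neg, abs_div, abs_of_nonneg (Real.sqrt_nonneg _), abs_mul]
    gcongr
    exact mul_le_one₀ (hr1 j) (abs_nonneg _) he
  refine le_trans (measureReal_mono ?_) (measureReal_le_abs_sum_pairs_le hZ hind hZi hZ2 hmean hvar hn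
    (fun j => hbd j _ (Real.abs_cos_le_one (ψ j))) (fun j => hbd j _ (Real.abs_sin_le_one (ψ j))) l)
  rintro ω ⟨h1, h2⟩
  refine ⟨h1, h2.trans_eq ?_⟩
  rw [trigPoly_eq_sum_range]
  congr 1
  refine Finset.sum_congr rfl fun j hj => ?_
  simp only [coeffFamily, Sum.elim_inl, Sum.elim_inr, hr, if_pos (Finset.mem_range.1 hj), hψ]
  ring

/-- Union bound over a coefficient exceeding √n and, at each grid point, a large second derivative
or a small ball event. The small ball cutoff L is taken equal to l. -/
lemma measureReal_infAbsAddAbsDeriv_lt_le {ν : Measure ℝ} [IsProbabilityMeasure ν]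
    (hZ : ∀ i, Measurable (coeffFamily x y i)) (hind : iIndepFun (coeffFamily x y) P)
    (hlaw : ∀ i, P.map (coeffFamily x y i) = ν)
    (hZi : ∀ i, Integrable (coeffFamily x y i) P)
    (hZ2 : ∀ i, Integrable (fun ω => coeffFamily x y i ω ^ 2) P)
    (hmean : ∀ i, ∫ ω, coeffFamily x y i ω ∂P = 0)
    (hvar : ∀ i, ∫ ω, coeffFamily x y i ω ^ 2 ∂P = 1) {q : ℕ} {M : ℝ}
    (hZq : ∀ i, Integrable (fun ω => |coeffFamily x y i ω| ^ q) P)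
    (hM : ∀ i, ∫ ω, |coeffFamily x y i ω| ^ q ∂P = M) {κ b : ℝ} (hκ : 0 < κ)
    (hdec : ∀ s t r₁ r₂ : ℝ, r₁ ≤ s ^ 2 + t ^ 2 → s ^ 2 + t ^ 2 ≤ r₂ →
      ‖charFun ν s * charFun ν t‖ ≤ Real.exp (-(κ * min r₁ (r₂ ^ (-(b / 2))))))
    {n : ℕ} (hn : 1 ≤ n) (φ : ℕ → ℝ) {a c δ ε l : ℝ} (hac : a ≤ c) (hδ0 : 0 < δ)
    (hnδ : n * δ ≤ 1) (hεδ : ε ≤ δ) (hl : 0 ≤ l) :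
    P.real {ω | infAbsAddAbsDeriv (trigPoly (fun k => x k ω) (fun k => y k ω) φ n) a c < ε} ≤
      2 * n * (M / √(n : ℝ) ^ q) + ((c - a) / δ + 1) * (2 * Real.exp (2 - l) +
        Real.exp 1 * (4 * (δ * (l + 4)) ^ 2 / κ +
          Real.exp (-(n / 2 * (κ * (2 * l ^ 2 / ((δ * (l + 4)) ^ 2 * n)) ^ (-(b / 2))))) +
          8 * Real.exp (-l))) := by
  have hn1 : (1 : ℝ) ≤ n := by exact_mod_cast hn
  have hδ1 : δ ≤ 1 := by nlinarith
  set E := 2 * Real.exp (2 - l) + Real.exp 1 * (4 * (δ * (l + 4)) ^ 2 / κ +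
          Real.exp (-(n / 2 * (κ * (2 * l ^ 2 / ((δ * (l + 4)) ^ 2 * n)) ^ (-(b / 2))))) +
          8 * Real.exp (-l)) with hE
  have hE0 : 0 ≤ E := by positivity
  have hB : 0 < √(n : ℝ) := Real.sqrt_pos.2 (by linarith)
  set s := (Finset.range n).disjSum (Finset.range n) with hs
  set N := ⌊(c - a) / δ⌋₊ + 1 with hN
  set bad : Set Ω := {ω | ∃ i ∈ s, √(n : ℝ) < |coeffFamily x y i ω|} with hbad
  set G₂ : ℕ → Set Ω := fun j =>
    {ω | (∀ j < n, |x (j + 1) ω| ≤ √(n : ℝ) ∧ |y (j + 1) ω| ≤ √(n : ℝ)) ∧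
      l ≤ |trigPoly (fun k => k / n * -(k / n * x k ω)) (fun k => -(k / n * (k / n * y k ω))) φ n
        (a + j * δ)|} with hG₂
  set G₁ : ℕ → Set Ω := fun j =>
    {ω | |trigPoly (fun k => x k ω) (fun k => y k ω) φ n (a + j * δ)| ≤ δ * (l + 4) ∧
      |trigPoly (fun k => k / n * y k ω) (fun k => -(k / n * x k ω)) φ n (a + j * δ)| ≤
        δ * (l + 4)} with hG₁
  have hsub : {ω | infAbsAddAbsDeriv (trigPoly (fun k => x k ω) (fun k => y k ω) φ n) a c < ε} ⊆
      bad ∪ ⋃ j ∈ Finset.range N, (G₂ j ∪ G₁ j) := by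
    intro ω hω
    by_cases hb : ω ∈ bad
    · exact Or.inl hb
    right
    simp only [hbad, Set.mem_ofPred_eq, not_exists, not_and, not_lt] at hb
    have hxj : ∀ j < n, |x (j + 1) ω| ≤ √(n : ℝ) := fun j hj =>
      hb (Sum.inl j) (by simpa [hs] using hj)
    have hyj : ∀ j < n, |y (j + 1) ω| ≤ √(n : ℝ) := fun j hj =>
      hb (Sum.inr j) (by simpa [hs] using hj)
    have hshift : ∀ k ∈ Finset.Icc 1 n, k - 1 < n ∧ k - 1 + 1 = k := fun k hk => by
      rw [Finset.mem_Icc] at hk; omega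
    obtain ⟨j, hj, h⟩ := exists_grid_point_of_infAbsAddAbsDeriv_lt (l := l) hac hδ0 hδ1 hnδ hεδ
      (fun k hk => by have := hxj _ (hshift k hk).1; rwa [(hshift k hk).2] at this)
      (fun k hk => by have := hyj _ (hshift k hk).1; rwa [(hshift k hk).2] at this) hω
    rw [Set.mem_iUnion₂]
    refine ⟨j, hj, ?_⟩
    rcases h with h | h
    · exact Or.inl ⟨fun j hj => ⟨hxj j hj, hyj j hj⟩, h⟩
    · exact Or.inr h
  refine (measureReal_mono hsub).trans ((measureReal_union_le _ _).trans (add_le_add ?_ ?_))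
  · refine (measureReal_exists_lt_abs_le hB hZq hM s).trans_eq ?_
    rw [hs, Finset.card_disjSum, Finset.card_range]
    push_cast
    ring
  · refine (measureReal_biUnion_finset_le _ _).trans ?_
    calc _ ≤ ∑ j ∈ Finset.range N, E := by
          refine Finset.sum_le_sum fun j _ => (measureReal_union_le _ _).trans (add_le_add ?_ ?_)
          · exact measureReal_trigPoly_deriv_deriv_le hZ hind hZi hZ2 hmean hvar hn φ _ l
          · exact measureReal_abs_trigPoly_le hZ hind hlaw hκ hdec hn φ _ (by positivity)
      _ = N * E := by simp
      _ ≤ _ := by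
        refine mul_le_mul_of_nonneg_right ?_ hE0
        rw [hN]
        push_cast
        have := Nat.floor_le (div_nonneg (sub_nonneg.2 hac) hδ0.le)
        linarith

end NonAsymptotic

/-! ### Choice of scales and the limit -/

section Asymptotic

open Filter Topology

lemma tendsto_rpow_mul_exp_neg_mul_rpow (s : ℝ) {c r : ℝ} (hc : 0 < c) (hr : 0 < r) :
    Tendsto (fun n : ℕ => (n : ℝ) ^ s * Real.exp (-(c * (n : ℝ) ^ r))) atTop (𝓝 0) := by
  have h := ((tendsto_rpow_mul_exp_neg_mul_atTop_nhds_zero (s / r) c hc).comp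
    (tendsto_rpow_atTop hr)).comp tendsto_natCast_atTop_atTop
  refine h.congr fun n => ?_
  simp only [Function.comp_apply]
  rw [← Real.rpow_mul (Nat.cast_nonneg n), mul_div_cancel₀ _ hr.ne', neg_mul]

/-- Here x is n, the interval has length D·x, the mesh is x^(-1-p) and l = x^(p/8): a growing power,
so exp(-l) beats the grid size, yet small enough that x^(2+p)(δl)² still decays. -/
lemma nonasymptotic_bound_le {M κ b p D x : ℝ} {q : ℕ} (hκ : 0 < κ) (hb : 0 ≤ b)
    (hp : 0 < p) (hD : 0 ≤ D) (hx : 1 ≤ x) :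
    2 * x * (M / √x ^ q) + (D * x / x ^ (-1 - p) + 1) * (2 * Real.exp (2 - x ^ (p / 8)) +
        Real.exp 1 * (4 * (x ^ (-1 - p) * (x ^ (p / 8) + 4)) ^ 2 / κ +
          Real.exp (-(x / 2 * (κ * (2 * (x ^ (p / 8)) ^ 2 /
            ((x ^ (-1 - p) * (x ^ (p / 8) + 4)) ^ 2 * x)) ^ (-(b / 2))))) +
          8 * Real.exp (-x ^ (p / 8)))) ≤
      2 * M * x ^ (-((q : ℝ) / 2 - 1)) + (D + 1) * ((2 * Real.exp 2 + 8 * Real.exp 1) *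
        (x ^ (2 + p) * Real.exp (-(1 * x ^ (p / 8)))) + Real.exp 1 * (100 / κ * x ^ (-(3 * p / 4)) +
          x ^ (2 + p) * Real.exp (-(κ / 2 * 2 ^ (-(b / 2)) * x ^ (1 - b * (1 / 2 + p)))))) := by
  have hx0 : 0 < x := by linarith
  set l := x ^ (p / 8) with hl
  set δ := x ^ (-1 - p) with hδ
  have hl1 : 1 ≤ l := Real.one_le_rpow hx (by positivity)
  have hδ0 : 0 < δ := by positivity
  have e1 : 2 * x * (M / √x ^ q) = 2 * M * x ^ (-((q : ℝ) / 2 - 1)) := by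
    have h : √x ^ q = x ^ ((q : ℝ) / 2) := by
      rw [Real.sqrt_eq_rpow, ← Real.rpow_natCast, ← Real.rpow_mul hx0.le]
      congr 1
      ring
    have h' : x ^ (-((q : ℝ) / 2 - 1)) = x / x ^ ((q : ℝ) / 2) := by
      rw [neg_sub, Real.rpow_sub hx0, Real.rpow_one]
    rw [h, h']
    ring
  have e2 : x / δ = x ^ (2 + p) := by
    rw [hδ, div_eq_iff (by positivity), ← Real.rpow_add hx0]
    ring_nf
    rw [Real.rpow_one]
  have e3 : D * x / δ + 1 ≤ (D + 1) * x ^ (2 + p) := by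
    rw [mul_div_assoc, e2]
    have : 1 ≤ x ^ (2 + p) := Real.one_le_rpow hx (by positivity)
    linarith
  have e4 : x ^ (2 + p) * (4 * (δ * (l + 4)) ^ 2 / κ) ≤ 100 / κ * x ^ (-(3 * p / 4)) := by
    -- Uses l ≥ 1; the constant 100 is 4·5². The exponent is (2+p) + 2(-1-p+p/8) = -3p/4.
    have h : δ * (l + 4) ≤ 5 * (δ * l) := by nlinarith
    have h' : x ^ (2 + p) * (δ * l) ^ 2 = x ^ (-(3 * p / 4)) := by
      rw [hδ, hl, ← Real.rpow_add hx0, ← Real.rpow_natCast, ← Real.rpow_mul hx0.le,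
        ← Real.rpow_add hx0]
      congr 1
      push_cast
      ring
    calc _ ≤ x ^ (2 + p) * (4 * (5 * (δ * l)) ^ 2 / κ) := by gcongr
      _ = 100 / κ * (x ^ (2 + p) * (δ * l) ^ 2) := by ring
      _ = _ := by rw [h']
  have e5 : Real.exp (-(x / 2 * (κ * (2 * l ^ 2 / ((δ * (l + 4)) ^ 2 * x)) ^ (-(b / 2))))) ≤
      Real.exp (-(κ / 2 * 2 ^ (-(b / 2)) * x ^ (1 - b * (1 / 2 + p)))) := by
    refine Real.exp_le_exp.2 (neg_le_neg ?_)
    have h1 : 2 * l ^ 2 / ((δ * (l + 4)) ^ 2 * x) ≤ 2 * x ^ (1 + 2 * p) := by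
      have h2 : x ^ (1 + 2 * p) * (δ ^ 2 * x) = 1 := by
        rw [hδ, ← Real.rpow_natCast, ← Real.rpow_mul hx0.le]
        nth_rewrite 3 [← Real.rpow_one x]
        rw [← Real.rpow_add hx0, ← Real.rpow_add hx0]
        push_cast
        ring_nf
        rw [Real.rpow_zero]
      rw [div_le_iff₀ (by positivity)]
      have h3 : l ^ 2 ≤ (l + 4) ^ 2 := by nlinarith
      calc 2 * l ^ 2 ≤ 2 * (x ^ (1 + 2 * p) * (δ ^ 2 * x)) * (l + 4) ^ 2 := by rw [h2]; linarith
        _ = _ := by ring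
    have h2 : (2 * x ^ (1 + 2 * p)) ^ (-(b / 2)) ≤
        (2 * l ^ 2 / ((δ * (l + 4)) ^ 2 * x)) ^ (-(b / 2)) :=
      Real.rpow_le_rpow_of_nonpos (by positivity) h1 (by linarith)
    have h3 : x * (2 * x ^ (1 + 2 * p)) ^ (-(b / 2)) =
        2 ^ (-(b / 2)) * x ^ (1 - b * (1 / 2 + p)) := by
      rw [Real.mul_rpow two_pos.le (by positivity), ← Real.rpow_mul hx0.le, mul_left_comm]
      nth_rewrite 1 [← Real.rpow_one x]
      rw [← Real.rpow_add hx0]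
      ring_nf
    calc _ = κ / 2 * (x * (2 * x ^ (1 + 2 * p)) ^ (-(b / 2))) := by rw [h3]; ring
      _ ≤ κ / 2 * (x * (2 * l ^ 2 / ((δ * (l + 4)) ^ 2 * x)) ^ (-(b / 2))) := by gcongr
      _ = _ := by ring
  rw [e1]
  refine add_le_add le_rfl ?_
  refine (mul_le_mul_of_nonneg_right e3 (by positivity)).trans ?_
  rw [mul_assoc]
  refine mul_le_mul_of_nonneg_left ?_ (by linarith)
  rw [show (2 : ℝ) - l = 2 + -l by ring, Real.exp_add, one_mul]
  have e6 := mul_le_mul_of_nonneg_left e5 (by positivity : 0 ≤ x ^ (2 + p))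
  have e7 := mul_le_mul_of_nonneg_left (add_le_add e4 e6) (Real.exp_pos 1).le
  linarith

lemma tendsto_nonasymptotic_bound (M D : ℝ) {κ b p : ℝ} {q : ℕ} (hκ : 0 < κ)
    (hp : 0 < p) (hq : 2 < q) (hbp : b * (1 / 2 + p) < 1) :
    Tendsto (fun n : ℕ => 2 * M * (n : ℝ) ^ (-((q : ℝ) / 2 - 1)) +
      (D + 1) * ((2 * Real.exp 2 + 8 * Real.exp 1) *
        ((n : ℝ) ^ (2 + p) * Real.exp (-(1 * (n : ℝ) ^ (p / 8)))) +
        Real.exp 1 * (100 / κ * (n : ℝ) ^ (-(3 * p / 4)) +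
          (n : ℝ) ^ (2 + p) *
            Real.exp (-(κ / 2 * 2 ^ (-(b / 2)) * (n : ℝ) ^ (1 - b * (1 / 2 + p)))))))
      atTop (𝓝 0) := by
  have hq' : (2 : ℝ) < q := by exact_mod_cast hq
  have t1 : Tendsto (fun n : ℕ => (n : ℝ) ^ (-((q : ℝ) / 2 - 1))) atTop (𝓝 0) :=
    (tendsto_rpow_neg_atTop (by linarith)).comp tendsto_natCast_atTop_atTop
  have t2 : Tendsto (fun n : ℕ => (n : ℝ) ^ (-(3 * p / 4))) atTop (𝓝 0) :=
    (tendsto_rpow_neg_atTop (by positivity)).comp tendsto_natCast_atTop_atTop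
  have t3 := tendsto_rpow_mul_exp_neg_mul_rpow (2 + p) one_pos (by positivity : 0 < p / 8)
  have t4 := tendsto_rpow_mul_exp_neg_mul_rpow (2 + p) (by positivity : 0 < κ / 2 * 2 ^ (-(b / 2)))
    (by linarith : 0 < 1 - b * (1 / 2 + p))
  simpa using (t1.const_mul (2 * M)).add (((t3.const_mul (2 * Real.exp 2 + 8 * Real.exp 1)).add
    (((t2.const_mul (100 / κ)).add t4).const_mul (Real.exp 1))).const_mul (D + 1))

end Asymptotic

/-! ### The limit theorem -/

theorem theorem5p3 {Ω : Type*} [MeasurableSpace Ω] (P : Measure Ω) [IsProbabilityMeasure P]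
    -- the two sequences of random coefficients, indexed by `k ≥ 1`, and the phases
    (x y : ℕ → Ω → ℝ) (φ : ℕ → ℝ)
    (hx : ∀ k, 1 ≤ k → Measurable (x k)) (hy : ∀ k, 1 ≤ k → Measurable (y k))
    -- all the `x k`, `y k` with `k ≥ 1` are mutually independent, with a common law
    (hindep : ProbabilityTheory.iIndepFun
      (Sum.elim (fun k : ℕ+ => x k) (fun k : ℕ+ => y k)) P)
    (hidx : ∀ k, 1 ≤ k → ProbabilityTheory.IdentDistrib (x k) (x 1) P P)
    (hidy : ∀ k, 1 ≤ k → ProbabilityTheory.IdentDistrib (y k) (x 1) P P)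
    -- centered, variance one, finite moment of integer order `q > 2`
    (q : ℕ) (hq : 2 < q)
    (hmean : ∫ ω, x 1 ω ∂P = 0) (hvar : ∫ ω, x 1 ω ^ 2 ∂P = 1)
    (hmoment : Integrable (fun ω => |x 1 ω| ^ q) P)
    -- the common law is in the class `C(1, b)`; `1 / b` is read as infinity for `b = 0`
    (b : ℝ) (hb : 0 ≤ b) (hcramer : WeakCramer (P.map (x 1)) b)
    (hqb : 0 < b → 1 / (q : ℝ) < 1 / b - 1 / 2)
    -- the interval and the exponent
    (α β : ℝ) (hαβ : α ≤ β) (θ : ℝ) (hθ : θ < -1 - 1 / (q : ℝ)) :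
    Filter.Tendsto
      (fun n : ℕ => P {ω | infAbsAddAbsDeriv
        (trigPoly (fun k => x k ω) (fun k => y k ω) φ n) (α * n) (β * n) < (n : ℝ) ^ θ})
      Filter.atTop (nhds 0) := by
  have hν := hcramer.1
  have hZ : ∀ i, Measurable (coeffFamily x y i) := by
    rintro (j | j)
    · exact hx _ (Nat.le_add_left 1 j)
    · exact hy _ (Nat.le_add_left 1 j)
  have hid : ∀ i, ProbabilityTheory.IdentDistrib (coeffFamily x y i) (x 1) P P := by
    rintro (j | j)
    · exact hidx _ (Nat.le_add_left 1 j)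
    · exact hidy _ (Nat.le_add_left 1 j)
  have hind : ProbabilityTheory.iIndepFun (coeffFamily x y) P := by
    have h := hindep.precomp (g := Sum.map Nat.succPNat Nat.succPNat)
      (Sum.map_injective.2 ⟨Nat.succPNat_injective, Nat.succPNat_injective⟩)
    convert h using 1
    funext i
    rcases i with j | j <;> rfl
  have hsq : Measurable fun z : ℝ => z ^ 2 := by fun_prop
  have habs : Measurable fun z : ℝ => |z| ^ q := by fun_prop
  have hLq : MemLp (x 1) q P := by
    rw [← integrable_norm_rpow_iff (hx 1 le_rfl).aestronglyMeasurable (by simp; omega) (by simp)]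
    simpa using hmoment
  have hL2 : MemLp (x 1) 2 P := hLq.mono_exponent (by exact_mod_cast hq.le)
  have hi1 : Integrable (x 1) P := hL2.integrable one_le_two
  obtain ⟨κ, hκ, hdec⟩ := hcramer.exists_norm_charFun_mul_le hb
  have hq0 : (0 : ℝ) < q := by exact_mod_cast (by omega : 0 < q)
  have hp : 0 < 1 / (q : ℝ) := by positivity
  -- The hypothesis on q and b multiplied through by b, a form that also covers b = 0.
  have hbp : b * (1 / 2 + 1 / (q : ℝ)) < 1 := by
    rcases hb.eq_or_lt with rfl | hb0
    · simp
    · have h := hqb hb0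
      calc b * (1 / 2 + 1 / (q : ℝ)) < b * (1 / b) := by gcongr; linarith
        _ = 1 := by field_simp
  set M := ∫ ω, |x 1 ω| ^ q ∂P
  have hreal : Filter.Tendsto
      (fun n : ℕ => P.real {ω | infAbsAddAbsDeriv
        (trigPoly (fun k => x k ω) (fun k => y k ω) φ n) (α * n) (β * n) < (n : ℝ) ^ θ})
      Filter.atTop (nhds 0) := by
    refine tendsto_of_tendsto_of_tendsto_of_le_of_le' tendsto_const_nhds
      (tendsto_nonasymptotic_bound M (β - α) hκ hp hq hbp)
      (Filter.Eventually.of_forall fun n => measureReal_nonneg) ?_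
    filter_upwards [Filter.eventually_ge_atTop 1] with n hn
    have hn1 : (1 : ℝ) ≤ n := by exact_mod_cast hn
    have hn0 : (0 : ℝ) < n := by linarith
    refine le_trans ?_ (nonasymptotic_bound_le hκ hb hp (sub_nonneg.2 hαβ) hn1)
    rw [sub_mul]
    refine measureReal_infAbsAddAbsDeriv_lt_le hZ hind (fun i => (hid i).map_eq)
      (fun i => (hid i).symm.integrable_snd hi1)
      (fun i => ((hid i).comp hsq).symm.integrable_snd hL2.integrable_sq)
      (fun i => (hid i).integral_eq.trans hmean) (fun i => ((hid i).comp hsq).integral_eq.trans hvar)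
      (fun i => ((hid i).comp habs).symm.integrable_snd hmoment)
      (fun i => ((hid i).comp habs).integral_eq) hκ hdec hn φ (by gcongr) (by positivity) ?_ ?_
      (by positivity)
    · nth_rewrite 1 [← Real.rpow_one (n : ℝ)]
      rw [← Real.rpow_add hn0]
      exact Real.rpow_le_one_of_one_le_of_nonpos hn1 (by linarith)
    · exact Real.rpow_le_rpow_of_exponent_le hn1 hθ.le
  have h := (ENNReal.continuous_ofReal.tendsto 0).comp hreal
  rw [ENNReal.ofReal_zero] at h
  refine h.congr fun n => ?_
  simp [measureReal_def]
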